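/- Let $p$ be an odd prime, let $q$ be a power of $p$, and let $n=p^k u$ be a positive integer, where $k\ge 0$ and $\gcd(u,p)=1$. For a positive integer $t$, let $W(t)$ be the number of square-free positive divisors of $t$; for a nonzero polynomial $f\in\mathbb F_q[x]$, let $W(f)$ be the number of monic square-free divisors of $f$ in $\mathbb F_q[x]$. An element $\alpha\in\mathbb F_{q^n}^*$ is called $2$-primitive if its multiplicative order is $(q^n-1)/2$. An element $\alpha\in\mathbb F_{q^n}$ is called normal over $\mathbb F_q$ if $\alpha,\alpha^q,\ldots,\alpha^{q^{n-1}}$ is a basis of $\mathbb F_{q^n}$ over $\mathbb F_q$, and $1$-normal over $\mathbb F_q$ if the $\mathbb F_q$-vector space spanned by $\alpha,\alpha^q,\ldots,\alpha^{q^{n-1}}$ has dimension $n-1$. Let $q'$ be the product of the distinct primes dividing $q^n-1$, let $\{p_1,\ldots,p_s\}$ be a (possibly empty, in which case $s=0$) set of distinct prime divisors of $q'$ such that $\delta:=1-\sum_{i=1}^s p_i^{-1}>0$, and put $q_0:=q'/(p_1\cdots p_s)$. Then the following hold. (a) If $$q^{n/2}>2\,W(q_0)\,W(x^u-1)\left(\frac{s-1}{\delta}+2\right),$$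 then there exists an element of $\mathbb F_{q^n}$ that is $2$-primitive and normal over $\mathbb F_q$. (b) If $$q^{p^k(u/2-1)}>W(q_0)\,W(x^u-1)\left(\frac{s-1}{\delta}+2\right),$$ then there exists an element of $\mathbb F_{q^n}$ that is $2$-primitive and $1$-normal over $\mathbb F_q$. -/

import Mathlib

namespace SieveCriterion

open Polynomial

/-- An element `α` of a finite field `K` is `r`-primitive, for a divisor `r` of `|K| - 1`, if it is
nonzero and has multiplicative order `(|K| - 1) / r`. -/
def IsRPrimitive {K : Type*} [Field K] (r : ℕ) (α : K) : Prop :=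
  α ≠ 0 ∧ r ∣ Nat.card K - 1 ∧ orderOf α = (Nat.card K - 1) / r

/-- `α ∈ K` is normal over the finite field `F` with `q` elements if its conjugates
`α, α ^ q, …, α ^ (q ^ (n - 1))`, where `n = [K : F]`, form an `F`-basis of `K`. -/
def IsNormalElement (F : Type*) {K : Type*} [Field F] [Field K] [Algebra F K] (α : K) : Prop :=
  LinearIndependent F (fun i : Fin (Module.finrank F K) => α ^ (Nat.card F ^ (i : ℕ))) ∧
    Submodule.span F
      (Set.range fun i : Fin (Module.finrank F K) => α ^ (Nat.card F ^ (i : ℕ))) = ⊤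

/-- `α ∈ K` is `k`-normal over the finite field `F` with `q` elements if the `F`-span of its
conjugates `α, α ^ q, …, α ^ (q ^ (n - 1))`, where `n = [K : F]`, has dimension `n - k`. -/
def IsKNormal (F : Type*) {K : Type*} [Field F] [Field K] [Algebra F K] (k : ℕ) (α : K) : Prop :=
  Module.finrank F (Submodule.span F
    (Set.range fun i : Fin (Module.finrank F K) => α ^ (Nat.card F ^ (i : ℕ)))) + k =
      Module.finrank F K

/-- The number of square-free divisors of a positive integer `t`. -/
noncomputable def natW (t : ℕ) : ℕ := {d : ℕ | Squarefree d ∧ d ∣ t}.ncard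

/-- The number of monic square-free divisors of a nonzero polynomial `f`. -/
noncomputable def polyW {F : Type*} [Field F] (f : F[X]) : ℕ :=
  {D : F[X] | D.Monic ∧ Squarefree D ∧ D ∣ f}.ncard

end SieveCriterion

/-! The square of a generator `β` of `Kˣ` is `2`-primitive, and `β` is a generator as soon as it is
no `ℓ`-th power for any prime `ℓ` dividing `|K| - 1`. On the additive side, Frobenius makes `K` a
cyclic `F[X]`-module annihilated by `X ^ n - 1 = (X ^ u - 1) ^ p ^ k`. For a generator `θ`, the
element `g θ` is normal if `g` is prime to `X ^ u - 1`, and `1`-normal if the gcd of `g` and `X ^ n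
- 1` is `X - 1`. Both conditions follow if `g θ` lies in a suitable coset and avoids the images of
certain irreducible polynomials.

It remains to find `β` with multiplicative conditions on `β` and additive ones on `β²`. Both are
expanded in characters, keeping track only of the total weight of the coefficients
(`indicator_avoid`, `exists_sieve_minorant`). Trivial characters give the main term. Every term with
a nontrivial additive character `ψ` is a sum of `χ(β) ψ(β²)`, at most `2√|K|` in size
(`norm_quadraticSum_one_le`). The primes in `P` enter only through the minorant `1 - ∑ 1_ℓ`, so they
cost `(s - 1) / δ + 2` instead of `2 ^ s`. `exists_unit_sq_avoid` compares main term and error.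

In (b) the coset costs an index of at most `q ^ p ^ k`, but the factor `X - 1` need not be avoided.
This saves a factor `2`, which cancels the one in the character sum bound. -/

namespace SieveCriterion

universe u v

/-! ### Characters with weights: cosets and avoidance of subgroups -/

section Fourier

variable {G : Type u} [AddCommGroup G]

/-- `f` is a linear combination of characters in `X` whose coefficients have total absolute value
at most `M`. -/
def FourierBound (X : Set (AddChar G ℂ)) (M : ℝ) (f : G → ℂ) : Prop :=
  ∃ (ι : Type u) (_ : Fintype ι) (c : ι → ℂ) (ψ : ι → AddChar G ℂ),
    (∀ i, ψ i ∈ X) ∧ ∑ i, ‖c i‖ ≤ M ∧ ∀ x, f x = ∑ i, c i * ψ i x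

lemma FourierBound.mono {X Y : Set (AddChar G ℂ)} {M N : ℝ} {f : G → ℂ}
    (h : FourierBound X M f) (hXY : X ⊆ Y) (hMN : M ≤ N) : FourierBound Y N f := by
  obtain ⟨ι, _, c, ψ, h1, h2, h3⟩ := h
  exact ⟨ι, _, c, ψ, fun i => hXY (h1 i), h2.trans hMN, h3⟩

lemma FourierBound.nonneg {X : Set (AddChar G ℂ)} {M : ℝ} {f : G → ℂ}
    (h : FourierBound X M f) : 0 ≤ M := by
  obtain ⟨ι, _, c, ψ, -, h2, -⟩ := h
  exact (Finset.sum_nonneg fun i _ => norm_nonneg _).trans h2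

lemma FourierBound.zero {X : Set (AddChar G ℂ)} : FourierBound X 0 (0 : G → ℂ) :=
  ⟨PEmpty, inferInstance, fun _ => 0, fun _ => 0, by simp, by simp, by simp⟩

lemma FourierBound.one {X : Set (AddChar G ℂ)} (hX : 0 ∈ X) : FourierBound X 1 (1 : G → ℂ) :=
  ⟨PUnit, inferInstance, fun _ => 1, fun _ => 0, by simpa using hX, by simp, by simp⟩

lemma FourierBound.smul {X : Set (AddChar G ℂ)} {M : ℝ} {f : G → ℂ} (a : ℂ)
    (h : FourierBound X M f) : FourierBound X (‖a‖ * M) (a • f) := by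
  obtain ⟨ι, _, c, ψ, h1, h2, h3⟩ := h
  refine ⟨ι, inferInstance, fun i => a * c i, ψ, h1, ?_, fun x => ?_⟩
  · simp_rw [norm_mul, ← Finset.mul_sum]
    gcongr
  · simp [h3, Finset.mul_sum, mul_assoc]

lemma FourierBound.neg {X : Set (AddChar G ℂ)} {M : ℝ} {f : G → ℂ}
    (h : FourierBound X M f) : FourierBound X M (-f) := by
  simpa using h.smul (-1)

lemma FourierBound.add {X : Set (AddChar G ℂ)} {M N : ℝ} {f g : G → ℂ}
    (hf : FourierBound X M f) (hg : FourierBound X N g) : FourierBound X (M + N) (f + g) := by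
  obtain ⟨ι, _, c, ψ, h1, h2, h3⟩ := hf
  obtain ⟨κ, _, d, φ, k1, k2, k3⟩ := hg
  refine ⟨ι ⊕ κ, inferInstance, Sum.elim c d, Sum.elim ψ φ, ?_, ?_, fun x => ?_⟩
  · rintro (i | i)
    exacts [h1 i, k1 i]
  · simpa [Fintype.sum_sum_type] using add_le_add h2 k2
  · simp [Fintype.sum_sum_type, h3, k3]

lemma FourierBound.sum {X : Set (AddChar G ℂ)} {κ : Type*} (s : Finset κ) {M : κ → ℝ}
    {f : κ → G → ℂ} (h : ∀ j ∈ s, FourierBound X (M j) (f j)) :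
    FourierBound X (∑ j ∈ s, M j) (∑ j ∈ s, f j) := by
  classical
  induction s using Finset.induction_on with
  | empty => simpa using FourierBound.zero
  | insert a s ha ih =>
    rw [Finset.sum_insert ha, Finset.sum_insert ha]
    exact (h a (by simp)).add (ih fun j hj => h j (by simp [hj]))

lemma FourierBound.mul {X Y Z : Set (AddChar G ℂ)} {M N : ℝ} {f g : G → ℂ}
    (hf : FourierBound X M f) (hg : FourierBound Y N g)
    (hZ : ∀ ψ ∈ X, ∀ φ ∈ Y, ψ + φ ∈ Z) : FourierBound Z (M * N) (f * g) := by
  have hM := hf.nonneg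
  obtain ⟨ι, _, c, ψ, h1, h2, h3⟩ := hf
  obtain ⟨κ, _, d, φ, k1, k2, k3⟩ := hg
  refine ⟨ι × κ, inferInstance, fun i => c i.1 * d i.2, fun i => ψ i.1 + φ i.2,
    fun i => hZ _ (h1 _) _ (k1 _), ?_, fun x => ?_⟩
  · simp_rw [norm_mul, Fintype.sum_prod_type, ← Finset.mul_sum, ← Finset.sum_mul]
    exact mul_le_mul h2 k2 (Finset.sum_nonneg fun i _ => norm_nonneg _) hM
  · simp only [Pi.mul_apply, h3, k3, Finset.sum_mul_sum, Fintype.sum_prod_type,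
      AddChar.add_apply]
    refine Finset.sum_congr rfl fun i _ => Finset.sum_congr rfl fun j _ => by ring

lemma FourierBound.norm_map_le {X : Set (AddChar G ℂ)} {M B : ℝ} {f : G → ℂ}
    (hf : FourierBound X M f) (Λ : (G → ℂ) →ₗ[ℂ] ℂ) (hB : 0 ≤ B)
    (h : ∀ ψ ∈ X, ‖Λ ψ‖ ≤ B) : ‖Λ f‖ ≤ M * B := by
  obtain ⟨ι, _, c, ψ, h1, h2, h3⟩ := hf
  have : f = ∑ i, c i • (ψ i : G → ℂ) := by
    ext x; simp [h3]
  rw [this, map_sum]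
  calc ‖∑ i, Λ (c i • (ψ i : G → ℂ))‖ ≤ ∑ i, ‖c i‖ * B := by
        refine (norm_sum_le _ _).trans (Finset.sum_le_sum fun i _ => ?_)
        rw [map_smul, norm_smul]
        exact mul_le_mul_of_nonneg_left (h _ (h1 i)) (norm_nonneg _)
    _ ≤ M * B := by
        rw [← Finset.sum_mul]
        exact mul_le_mul_of_nonneg_right h2 hB

/-- The nontrivial characters of `G` that are trivial on `H`. -/
def annihilatorNe (H : AddSubgroup G) : Set (AddChar G ℂ) := {ψ | ψ ≠ 0 ∧ ∀ x ∈ H, ψ x = 1}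

variable [Finite G]

open Classical in
-- Orthogonality on `G ⧸ H`: all its characters enter with a coefficient of absolute value one, and
-- the trivial one is split off.
lemma indicator_coset (H : AddSubgroup G) (a : G) :
    ∃ R : G → ℂ, FourierBound (annihilatorNe H) (H.index - 1) R ∧
      ∀ x, (if x - a ∈ H then 1 else 0 : ℂ) = (H.index : ℂ)⁻¹ * (1 + R x) := by
  have : Fintype (G ⧸ H) := Fintype.ofFinite _
  let mk : G →+ G ⧸ H := QuotientAddGroup.mk' H
  have hmk : Function.Surjective mk := QuotientAddGroup.mk'_surjective H
  have hcard : (H.index : ℂ) = Fintype.card (G ⧸ H) := by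
    rw [AddSubgroup.index, Nat.card_eq_fintype_card]
  refine ⟨fun x => ∑ ψ : {ψ : AddChar (G ⧸ H) ℂ // ψ ≠ 0}, ψ.1 (mk (-a)) * ψ.1 (mk x),
    ⟨{ψ : AddChar (G ⧸ H) ℂ // ψ ≠ 0}, inferInstance, fun ψ => ψ.1 (mk (-a)),
      fun ψ => ψ.1.compAddMonoidHom mk, ?_, ?_, ?_⟩, ?_⟩
  · rintro ⟨ψ, hψ⟩
    refine ⟨fun h0 => hψ ?_, fun x hx => ?_⟩
    · ext y
      obtain ⟨x, rfl⟩ := hmk y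
      exact DFunLike.congr_fun h0 x
    · have : mk x = 0 := (QuotientAddGroup.eq_zero_iff x).2 hx
      simp [this]
  · have h1 : Fintype.card {ψ : AddChar (G ⧸ H) ℂ // ψ ≠ 0} + 1 = H.index := by
      rw [Fintype.card_subtype_compl, Fintype.card_subtype_eq, AddSubgroup.index,
        Nat.card_eq_fintype_card, AddChar.card_eq, Nat.sub_add_cancel Fintype.card_pos]
    simp only [AddChar.norm_apply, Finset.sum_const, Finset.card_univ, nsmul_eq_mul, mul_one]
    rw [← h1]; simp
  · intro x; rfl
  · intro x
    have h1 := AddChar.sum_apply_eq_ite (mk (x - a))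
    have h2 : mk (x - a) = 0 ↔ x - a ∈ H := QuotientAddGroup.eq_zero_iff _
    have h3 : ∑ ψ : AddChar (G ⧸ H) ℂ, ψ (mk (x - a)) =
        1 + ∑ ψ : {ψ : AddChar (G ⧸ H) ℂ // ψ ≠ 0}, ψ.1 (mk (-a)) * ψ.1 (mk x) := by
      rw [Fintype.sum_eq_add_sum_subtype_ne _ 0]
      congr 1
      · refine Finset.sum_congr rfl fun ψ _ => ?_
        rw [← AddChar.map_add_eq_mul, ← map_add, neg_add_eq_sub]
    rw [← h3, h1, hcard, if_congr h2 rfl rfl]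
    have : (Fintype.card (G ⧸ H) : ℂ) ≠ 0 := by simp
    by_cases hx : x - a ∈ H <;> simp [hx, this]

open Classical in
-- Dividing the nontrivial part by `H.index - 1` normalises its weight to one. Later bounds
-- therefore count subgroups and do not see their indices.
lemma indicator_subgroup (H : AddSubgroup G) (hH : H ≠ ⊤) :
    ∃ U : G → ℂ, FourierBound (annihilatorNe H) 1 U ∧
      ∀ x, (if x ∈ H then 1 else 0 : ℂ) = (H.index : ℂ)⁻¹ + (1 - (H.index : ℂ)⁻¹) * U x := by
  obtain ⟨R, h1, h2⟩ := indicator_coset H 0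
  have hi : 1 < H.index := by
    have := H.index_ne_zero_of_finite
    have := mt AddSubgroup.index_eq_one.1 hH
    omega
  have hi' : (1 : ℝ) < H.index := by exact_mod_cast hi
  have hc : ((H.index : ℂ) - 1) ≠ 0 := by
    rw [sub_ne_zero]; exact_mod_cast hi.ne'
  have hc0 : (H.index : ℂ) ≠ 0 := by exact_mod_cast (by omega : H.index ≠ 0)
  refine ⟨((H.index : ℂ) - 1)⁻¹ • R, (h1.smul _).mono le_rfl ?_, fun x => ?_⟩
  · have : ((H.index : ℂ) - 1) = ((H.index - 1 : ℝ) : ℂ) := by push_cast; rfl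
    rw [this, norm_inv, Complex.norm_real, Real.norm_of_nonneg (by linarith),
      inv_mul_cancel₀ (by linarith)]
  · have := h2 x
    rw [sub_zero] at this
    rw [this]
    simp only [Pi.smul_apply, smul_eq_mul]
    field_simp

omit [Finite G] in
-- If the sum were trivial, the first character would be trivial on `V` as well as on `H`, hence on
-- `V ⊔ H = ⊤`. This is where independence of the conditions enters.
lemma add_mem_annihilatorNe {H V : AddSubgroup G} (h : V ⊔ H = ⊤) {ψ φ : AddChar G ℂ}
    (hψ : ψ ∈ annihilatorNe H) (hφ : φ ∈ annihilatorNe V) :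
    ψ + φ ∈ annihilatorNe (H ⊓ V) := by
  refine ⟨fun h0 => hψ.1 ?_, fun x hx => ?_⟩
  · ext x
    obtain ⟨y, hy, z, hz, rfl⟩ := AddSubgroup.mem_sup.1 (h ▸ AddSubgroup.mem_top x)
    have h1 : (ψ + φ) y = 1 := by rw [h0]; simp
    rw [AddChar.add_apply, hφ.2 y hy, mul_one] at h1
    rw [AddChar.map_add_eq_mul, h1, hψ.2 z hz]; simp
  · rw [AddChar.add_apply, hψ.2 x hx.1, hφ.2 x hx.2, mul_one]

omit [Finite G] in
lemma annihilatorNe_anti {H V : AddSubgroup G} (h : H ≤ V) : annihilatorNe V ⊆ annihilatorNe H :=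
  fun _ hψ => ⟨hψ.1, fun x hx => hψ.2 x (h hx)⟩

open Classical in
/-- Fourier expansion of the indicator of the elements of a coset of `W` that avoid each of a
family of independent subgroups. -/
lemma indicator_avoid {ι : Type v} (W : AddSubgroup G) (a : G) (V : ι → AddSubgroup G)
    (t : Finset ι) (hV : ∀ i ∈ t, V i ≠ ⊤)
    (hind : ∀ s ⊆ t, ∀ i ∈ t, i ∉ s → V i ⊔ (W ⊓ s.inf V) = ⊤) :
    ∃ (κ : ℝ) (R : G → ℂ), 0 < κ ∧
      FourierBound (annihilatorNe (W ⊓ t.inf V)) (W.index * 2 ^ t.card - 1) R ∧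
      ∀ x, (if x - a ∈ W ∧ ∀ i ∈ t, x ∉ V i then 1 else 0 : ℂ) = κ * (1 + R x) := by
  induction t using Finset.induction_on with
  | empty =>
    obtain ⟨R, h1, h2⟩ := indicator_coset W a
    refine ⟨(W.index : ℝ)⁻¹, R, ?_, by simpa using h1, fun x => by simpa using h2 x⟩
    have := W.index_ne_zero_of_finite
    positivity
  | insert i t hi ih =>
    obtain ⟨κ, R, hκ, hR, hx⟩ := ih (fun j hj => hV j (by simp [hj]))
      (fun s hs j hj hjs => hind s (hs.trans (by simp)) j (by simp [hj]) hjs)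
    obtain ⟨U, hU, hUx⟩ := indicator_subgroup (V i) (hV i (by simp))
    have hidx : 1 < (V i).index := by
      have := (V i).index_ne_zero_of_finite
      have := mt AddSubgroup.index_eq_one.1 (hV i (by simp))
      omega
    have hinv : ((V i).index : ℝ)⁻¹ < 1 := inv_lt_one_of_one_lt₀ (by exact_mod_cast hidx)
    have hi2 := hind t (by simp) i (by simp) hi
    have hset : W ⊓ (insert i t).inf V = (W ⊓ t.inf V) ⊓ V i := by
      rw [Finset.inf_insert, inf_assoc, inf_comm (V i)]
    -- The new factor is `(1 - 1/m)(1 - U)` with `m` the index of `V i`, and `(1 + R)(1 - U) = 1 +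
    -- (R - U - R U)`. A weight `N` becomes `2 N + 1`, so weight plus one doubles.
    refine ⟨κ * (1 - ((V i).index : ℝ)⁻¹), R + (-U + -(R * U)), by nlinarith, ?_, fun x => ?_⟩
    · rw [hset, Finset.card_insert_of_notMem hi]
      have hU' := hU.mono (annihilatorNe_anti (inf_le_right (a := W ⊓ t.inf V))) le_rfl
      have hR' := hR.mono (annihilatorNe_anti (inf_le_left (b := V i))) le_rfl
      have hRU := hR.mul hU (fun ψ hψ φ hφ => add_mem_annihilatorNe hi2 hψ hφ)
      refine (hR'.add (hU'.neg.add hRU.neg)).mono le_rfl (le_of_eq ?_)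
      ring
    · have h1 := hx x
      have h2 := hUx x
      have h3 : (if x - a ∈ W ∧ ∀ j ∈ insert i t, x ∉ V j then 1 else 0 : ℂ) =
          (if x - a ∈ W ∧ ∀ j ∈ t, x ∉ V j then 1 else 0) * (1 - if x ∈ V i then 1 else 0) := by
        by_cases k1 : x ∈ V i
        · simp [k1]
        · simp [k1]
      rw [h3, h1, h2]
      simp only [Pi.add_apply, Pi.neg_apply, Pi.mul_apply]
      push_cast
      ring

end Fourier

/-! ### The mixed sum of `χ(β) ψ(β²)` -/

section CharacterSum

variable {K : Type u} [Field K] [Fintype K] [DecidableEq K]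

omit [Fintype K] in
lemma card_units_sq_eq_le [Fintype Kˣ] (c : K) :
    (Finset.univ.filter fun t : Kˣ => (t : K) ^ 2 = c).card ≤ 2 := by
  rcases (Finset.univ.filter fun t : Kˣ => (t : K) ^ 2 = c).eq_empty_or_nonempty with h | ⟨t₀, h⟩
  · simp [h]
  · refine (Finset.card_le_card (t := {t₀, -t₀}) fun t ht => ?_).trans Finset.card_le_two
    simp only [Finset.mem_filter, Finset.mem_univ, true_and] at h ht
    rw [← h, sq_eq_sq_iff_eq_or_eq_neg] at ht
    simpa [Units.ext_iff] using ht

/-- The sum of `χ(β) ψ(c β²)` over the nonzero `β`. -/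
noncomputable def quadraticSum (χ : AddChar (Additive Kˣ) ℂ) (ψ : AddChar K ℂ) (c : K) : ℂ :=
  ∑ β : Kˣ, χ (Additive.ofMul β) * ψ (c * (β : K) ^ 2)

lemma norm_quadraticSum_sq (χ : AddChar (Additive Kˣ) ℂ) (ψ : AddChar K ℂ) (t : Kˣ) :
    ‖quadraticSum χ ψ ((t : K) ^ 2)‖ = ‖quadraticSum χ ψ 1‖ := by
  have h : quadraticSum χ ψ 1 = χ (Additive.ofMul t) * quadraticSum χ ψ ((t : K) ^ 2) := by
    unfold quadraticSum
    rw [← Equiv.sum_comp (Equiv.mulLeft t), Finset.mul_sum]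
    refine Finset.sum_congr rfl fun β _ => ?_
    rw [Equiv.coe_mulLeft, ofMul_mul, AddChar.map_add_eq_mul, Units.val_mul, mul_pow, one_mul,
      mul_assoc]
  rw [h, norm_mul, AddChar.norm_apply, one_mul]

/-- Second moment over all `c`: orthogonality keeps only the pairs with `γ² = β²`, at most two `γ`
for each `β`. -/
lemma sum_norm_quadraticSum_le (χ : AddChar (Additive Kˣ) ℂ) {ψ : AddChar K ℂ} (hψ : ψ ≠ 0) :
    ∑ c, ‖quadraticSum χ ψ c‖ ^ 2 ≤ Fintype.card Kˣ * (2 * Fintype.card K) := by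
  have hprim : ψ.IsPrimitive := AddChar.IsPrimitive.of_ne_one hψ
  have h1 : ((∑ c, ‖quadraticSum χ ψ c‖ ^ 2 : ℝ) : ℂ) =
      ∑ β : Kˣ, ∑ γ : Kˣ, χ (Additive.ofMul β) * χ (-Additive.ofMul γ) *
        if (γ : K) ^ 2 = (β : K) ^ 2 then (Fintype.card K : ℂ) else 0 := by
    push_cast
    simp_rw [← Complex.mul_conj']
    calc _ = ∑ c, ∑ β : Kˣ, ∑ γ : Kˣ, χ (Additive.ofMul β) * χ (-Additive.ofMul γ) *
          ψ (c * ((β : K) ^ 2 - (γ : K) ^ 2)) := by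
          refine Finset.sum_congr rfl fun c _ => ?_
          simp only [quadraticSum]
          rw [map_sum, Finset.sum_mul_sum]
          refine Finset.sum_congr rfl fun β _ => Finset.sum_congr rfl fun γ _ => ?_
          rw [map_mul (starRingEnd ℂ), ← AddChar.map_neg_eq_conj, ← AddChar.map_neg_eq_conj, mul_sub,
            sub_eq_add_neg, AddChar.map_add_eq_mul]
          ring
      _ = _ := by
          rw [Finset.sum_comm]
          refine Finset.sum_congr rfl fun β _ => ?_
          rw [Finset.sum_comm]
          refine Finset.sum_congr rfl fun γ _ => ?_
          rw [← Finset.mul_sum, AddChar.sum_mulShift _ hprim]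
          simp only [sub_eq_zero, eq_comm (a := (β : K) ^ 2)]
          push_cast
          rfl
  have h2 : (0 : ℝ) ≤ ∑ c, ‖quadraticSum χ ψ c‖ ^ 2 :=
    Finset.sum_nonneg fun _ _ => by positivity
  rw [← Real.norm_of_nonneg h2, ← Complex.norm_real, h1]
  refine (norm_sum_le _ _).trans ?_
  rw [← nsmul_eq_mul, ← Finset.card_univ (α := Kˣ)]
  refine Finset.sum_le_card_nsmul _ _ _ fun β _ => (norm_sum_le _ _).trans ?_
  have h3 : ∀ γ : Kˣ, ‖χ (Additive.ofMul β) * χ (-Additive.ofMul γ) *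
        if (γ : K) ^ 2 = (β : K) ^ 2 then (Fintype.card K : ℂ) else 0‖ =
      if (γ : K) ^ 2 = (β : K) ^ 2 then (Fintype.card K : ℝ) else 0 := by
    intro γ
    rw [norm_mul, norm_mul, AddChar.norm_apply, AddChar.norm_apply]
    split_ifs <;> simp
  simp_rw [h3]
  rw [← Finset.sum_filter, Finset.sum_const, nsmul_eq_mul]
  refine mul_le_mul_of_nonneg_right ?_ (by positivity)
  exact ((Nat.cast_le (α := ℝ)).2 (card_units_sq_eq_le ((β : K) ^ 2))).trans (by norm_num)

/-- Substituting `tβ` for `β` shows that all sums with `c = t²` have the same norm, and each `c` has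
at most two square roots. The second moment then bounds this common value, with no appeal to Weil's
theorem. -/
lemma norm_quadraticSum_one_le (χ : AddChar (Additive Kˣ) ℂ) {ψ : AddChar K ℂ} (hψ : ψ ≠ 0) :
    ‖quadraticSum χ ψ 1‖ ≤ 2 * √(Fintype.card K) := by
  have h1 : Fintype.card Kˣ * ‖quadraticSum χ ψ 1‖ ^ 2 ≤
      2 * ∑ c, ‖quadraticSum χ ψ c‖ ^ 2 := by
    calc _ = ∑ t : Kˣ, ‖quadraticSum χ ψ ((t : K) ^ 2)‖ ^ 2 := by
          simp [norm_quadraticSum_sq]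
      _ = ∑ t : Kˣ, ∑ c : K, if (t : K) ^ 2 = c then ‖quadraticSum χ ψ c‖ ^ 2 else 0 := by
          simp
      _ = ∑ c : K, (Finset.univ.filter fun t : Kˣ => (t : K) ^ 2 = c).card *
            ‖quadraticSum χ ψ c‖ ^ 2 := by
          rw [Finset.sum_comm]
          refine Finset.sum_congr rfl fun c _ => ?_
          rw [← Finset.sum_filter, Finset.sum_const, nsmul_eq_mul]
      _ ≤ _ := by
          rw [Finset.mul_sum]
          gcongr
          exact_mod_cast card_units_sq_eq_le _
  have h2 := sum_norm_quadraticSum_le χ hψ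
  have h3 : (0 : ℝ) < Fintype.card Kˣ := by exact_mod_cast Fintype.card_pos
  have h4 : ‖quadraticSum χ ψ 1‖ ^ 2 ≤ 4 * Fintype.card K := by
    refine le_of_mul_le_mul_left ?_ h3
    linarith
  refine abs_le_of_sq_le_sq' ?_ (by positivity) |>.2
  rw [mul_pow, Real.sq_sqrt (by positivity)]
  linarith

end CharacterSum

/-! ### The prime sieve and the comparison of main term and error -/

section Sieve

/-- Bézout for `ℓ` and the product of `s` writes every element as a multiple of `ℓ` plus a multiple
of all `m ∈ s`. -/
lemma sup_inf_range_nsmul_eq_top {A : Type u} [AddCommGroup A] (s : Finset ℕ) (ℓ : ℕ)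
    (h : ∀ m ∈ s, ℓ.Coprime m) :
    (nsmulAddMonoidHom ℓ : A →+ A).range ⊔
      s.inf (fun m => (nsmulAddMonoidHom m : A →+ A).range) = ⊤ := by
  rw [eq_top_iff]
  intro x _
  have hc : ℓ.Coprime (∏ m ∈ s, m) := Nat.Coprime.prod_right h
  have hb : (1 : ℤ) = ℓ * ℓ.gcdA (∏ m ∈ s, m) + (∏ m ∈ s, m : ℕ) * ℓ.gcdB (∏ m ∈ s, m) := by
    rw [← Nat.gcd_eq_gcd_ab, hc.gcd_eq_one, Nat.cast_one]
  have hx : x = ℓ • (ℓ.gcdA (∏ m ∈ s, m) • x) +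
      (∏ m ∈ s, m) • (ℓ.gcdB (∏ m ∈ s, m) • x) := by
    rw [← natCast_zsmul, ← natCast_zsmul, ← mul_smul, ← mul_smul, ← add_smul, ← hb, one_smul]
  rw [hx]
  refine AddSubgroup.add_mem_sup ⟨_, rfl⟩ ?_
  have : ∀ m ∈ s, (∏ m ∈ s, m) • (ℓ.gcdB (∏ m ∈ s, m) • x) ∈
      (nsmulAddMonoidHom m : A →+ A).range := by
    intro m hm
    obtain ⟨k, hk⟩ := Finset.dvd_prod_of_mem (fun m => m) hm
    refine ⟨k • (ℓ.gcdB (∏ m ∈ s, m) • x), ?_⟩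
    rw [nsmulAddMonoidHom_apply, ← mul_smul]
    congr 1
    exact hk.symm
  have hle : AddSubgroup.zmultiples ((∏ m ∈ s, m) • (ℓ.gcdB (∏ m ∈ s, m) • x)) ≤
      s.inf (fun m => (nsmulAddMonoidHom m : A →+ A).range) :=
    Finset.le_inf fun m hm => AddSubgroup.zmultiples_le_of_mem (this m hm)
  exact hle (AddSubgroup.mem_zmultiples _)

open Classical in
/-- Prime sieve on the nonzero elements: the function `F` is, up to a positive factor, a lower bound
for the indicator of the elements that are not `ℓ`-th powers for any `ℓ ∈ L ∪ P`. -/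
lemma exists_sieve_minorant {A : Type u} [AddCommGroup A] [Finite A] [IsAddCyclic A]
    (L P : Finset ℕ) (hL : ∀ ℓ ∈ L, ℓ.Prime ∧ ℓ ∣ Nat.card A)
    (hP : ∀ ℓ ∈ P, ℓ.Prime ∧ ℓ ∣ Nat.card A) (hLP : Disjoint L P) (δ : ℝ)
    (hδ : δ = 1 - ∑ ℓ ∈ P, (ℓ : ℝ)⁻¹) (hδ_pos : 0 < δ) :
    ∃ (κ : ℝ) (F : A → ℂ), 0 < κ ∧
      FourierBound {ψ | ψ ≠ 0} (δ * (2 ^ L.card - 1) + (P.card - 1 + δ) * 2 ^ L.card) F ∧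
      ∀ x, κ * (δ + F x) =
        (if ∀ ℓ ∈ L, x ∉ (nsmulAddMonoidHom ℓ : A →+ A).range then 1 else 0) *
        (1 - ∑ ℓ ∈ P, if x ∈ (nsmulAddMonoidHom ℓ : A →+ A).range then 1 else 0) := by
  set V : ℕ → AddSubgroup A := fun ℓ => (nsmulAddMonoidHom ℓ : A →+ A).range with hVdef
  have hidx : ∀ ℓ ∈ L ∪ P, (V ℓ).index = ℓ := by
    intro ℓ hℓ
    have : ℓ ∣ Nat.card A := by
      rcases Finset.mem_union.1 hℓ with h | h
      exacts [(hL ℓ h).2, (hP ℓ h).2]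
    rw [hVdef, IsAddCyclic.index_nsmulAddMonoidHom_range, Nat.gcd_eq_right this]
  have hprime : ∀ ℓ ∈ L ∪ P, ℓ.Prime := by
    intro ℓ hℓ
    rcases Finset.mem_union.1 hℓ with h | h
    exacts [(hL ℓ h).1, (hP ℓ h).1]
  have hne : ∀ ℓ ∈ L ∪ P, V ℓ ≠ ⊤ := by
    intro ℓ hℓ h
    have := hidx ℓ hℓ
    rw [h, AddSubgroup.index_top] at this
    exact (hprime ℓ hℓ).one_lt.ne this
  have hsup : ∀ s ⊆ L ∪ P, ∀ ℓ ∈ L ∪ P, ℓ ∉ s → V ℓ ⊔ (⊤ ⊓ s.inf V) = ⊤ := by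
    intro s hs ℓ hℓ hℓs
    rw [top_inf_eq]
    refine sup_inf_range_nsmul_eq_top s ℓ fun m hm => ?_
    refine (Nat.coprime_primes (hprime ℓ hℓ) (hprime m (hs hm))).2 ?_
    rintro rfl
    exact hℓs hm
  obtain ⟨κ, R, hκ, hR, hRx⟩ := indicator_avoid ⊤ 0 V L
    (fun ℓ hℓ => hne ℓ (Finset.mem_union_left _ hℓ))
    (fun s hs ℓ hℓ hℓs => hsup s (hs.trans Finset.subset_union_left) ℓ
      (Finset.mem_union_left _ hℓ) hℓs)
  rw [AddSubgroup.index_top, Nat.cast_one, one_mul] at hR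
  have hU' : ∀ ℓ : ℕ, ∃ U : A → ℂ, ℓ ∈ P → FourierBound (annihilatorNe (V ℓ)) 1 U ∧
      ∀ x, (if x ∈ V ℓ then 1 else 0 : ℂ) = (ℓ : ℂ)⁻¹ + (1 - (ℓ : ℂ)⁻¹) * U x := by
    intro ℓ
    by_cases hℓ : ℓ ∈ P
    · obtain ⟨U, h1, h2⟩ := indicator_subgroup (V ℓ) (hne ℓ (Finset.mem_union_right _ hℓ))
      rw [hidx ℓ (Finset.mem_union_right _ hℓ)] at h2
      exact ⟨U, fun _ => ⟨h1, h2⟩⟩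
    · exact ⟨0, fun h => absurd h hℓ⟩
  choose U hU using hU'
  have hXne : ∀ H : AddSubgroup A, annihilatorNe H ⊆ {ψ | ψ ≠ 0} := fun H ψ hψ => hψ.1
  have hterm : ∀ ℓ ∈ P, FourierBound {ψ : AddChar A ℂ | ψ ≠ 0} ((1 - (ℓ : ℝ)⁻¹) * 2 ^ L.card)
      ((-(1 - (ℓ : ℂ)⁻¹)) • (U ℓ + R * U ℓ)) := by
    intro ℓ hℓ
    have h1 := (hU ℓ hℓ).1
    have h2 := hR.mul h1 fun ψ hψ φ hφ => add_mem_annihilatorNe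
      (hsup L Finset.subset_union_left ℓ (Finset.mem_union_right _ hℓ)
        (Finset.disjoint_right.1 hLP hℓ)) hψ hφ
    refine (((h1.mono (hXne _) le_rfl).add (h2.mono (hXne _) le_rfl)).smul _).mono le_rfl
      (le_of_eq ?_)
    have h3 : (1 : ℂ) - (ℓ : ℂ)⁻¹ = ((1 - (ℓ : ℝ)⁻¹ : ℝ) : ℂ) := by push_cast; rfl
    have h4 : (ℓ : ℝ)⁻¹ ≤ 1 := Nat.cast_inv_le_one ℓ
    rw [norm_neg, h3, Complex.norm_real, Real.norm_of_nonneg (by linarith)]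
    ring
  -- Expansion of `(1 + R)(δ - ∑ (1 - 1/ℓ) U_ℓ)`. Since `U_ℓ + R U_ℓ` has weight `2 ^ L.card` and `∑
  -- (1 - 1/ℓ) = P.card - 1 + δ`, the stated weight results.
  refine ⟨κ, (δ : ℂ) • R + ∑ ℓ ∈ P, (-(1 - (ℓ : ℂ)⁻¹)) • (U ℓ + R * U ℓ), hκ, ?_, fun x => ?_⟩
  · refine (((hR.mono (hXne _) le_rfl).smul _).add (FourierBound.sum P hterm)).mono le_rfl
      (le_of_eq ?_)
    rw [Complex.norm_real, Real.norm_of_nonneg hδ_pos.le, ← Finset.sum_mul, hδ]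
    simp only [Finset.sum_sub_distrib, Finset.sum_const, nsmul_eq_mul, mul_one]
    ring
  · have h1 : (if ∀ ℓ ∈ L, x ∉ V ℓ then 1 else 0 : ℂ) = κ * (1 + R x) := by
      simpa using hRx x
    rw [h1, Finset.sum_congr rfl fun ℓ hℓ => (hU ℓ hℓ).2 x]
    simp only [Pi.add_apply, Pi.smul_apply, Finset.sum_apply, Pi.mul_apply, smul_eq_mul, hδ]
    have h2 : ∑ ℓ ∈ P, -(1 - (ℓ : ℂ)⁻¹) * (U ℓ x + R x * U ℓ x) =
        -((1 + R x) * ∑ ℓ ∈ P, (1 - (ℓ : ℂ)⁻¹) * U ℓ x) := by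
      rw [Finset.mul_sum, ← Finset.sum_neg_distrib]
      exact Finset.sum_congr rfl fun ℓ _ => by ring
    rw [h2, Finset.sum_add_distrib]
    push_cast
    ring

lemma one_le_sieve_constant (P : Finset ℕ) (δ : ℝ) (hδ : δ = 1 - ∑ ℓ ∈ P, (ℓ : ℝ)⁻¹)
    (hδ_pos : 0 < δ) : 1 ≤ ((P.card : ℝ) - 1) / δ + 2 := by
  rcases P.eq_empty_or_nonempty with rfl | hP
  · simp at hδ; subst hδ; norm_num
  · have : (1 : ℝ) ≤ P.card := by exact_mod_cast hP.card_pos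
    have : 0 ≤ ((P.card : ℝ) - 1) / δ := div_nonneg (by linarith) hδ_pos.le
    linarith

open Classical in
/-- Existence of a unit `β` that is not an `ℓ`-th power for any `ℓ ∈ L ∪ P`, and whose square lies
in a given coset of `W` and avoids the independent subgroups `V i`. -/
theorem exists_unit_sq_avoid {K : Type u} [Field K] [Finite K] {ι : Type v}
    (L P : Finset ℕ) (hL : ∀ ℓ ∈ L, ℓ.Prime ∧ ℓ ∣ Nat.card K - 1)
    (hP : ∀ ℓ ∈ P, ℓ.Prime ∧ ℓ ∣ Nat.card K - 1) (hLP : Disjoint L P) (δ : ℝ)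
    (hδ : δ = 1 - ∑ ℓ ∈ P, (ℓ : ℝ)⁻¹) (hδ_pos : 0 < δ)
    (W : AddSubgroup K) (a : K) (V : ι → AddSubgroup K) (t : Finset ι)
    (hV : ∀ i ∈ t, V i ≠ ⊤)
    (hind : ∀ s ⊆ t, ∀ i ∈ t, i ∉ s → V i ⊔ (W ⊓ s.inf V) = ⊤)
    (h : 2 * 2 ^ L.card * (W.index * 2 ^ t.card) * (((P.card : ℝ) - 1) / δ + 2) <
      √(Nat.card K)) :
    ∃ β : Kˣ, (∀ ℓ ∈ L ∪ P, ∀ γ : Kˣ, γ ^ ℓ ≠ β) ∧ (β : K) ^ 2 - a ∈ W ∧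
      ∀ i ∈ t, (β : K) ^ 2 ∉ V i := by
  have : Fintype K := Fintype.ofFinite K
  by_contra! hcon
  have hcardu : Nat.card (Additive Kˣ) = Nat.card K - 1 := by
    rw [← Nat.card_units]; rfl
  obtain ⟨κ₁, F, hκ₁, hF, hFx⟩ := exists_sieve_minorant (A := Additive Kˣ) L P
    (by rwa [hcardu]) (by rwa [hcardu]) hLP δ hδ hδ_pos
  obtain ⟨κ₂, R, hκ₂, hR, hRx⟩ := indicator_avoid W a V t hV hind
  set m : ℝ := (Fintype.card Kˣ : ℝ) with hm
  set N : ℝ := W.index * 2 ^ t.card - 1 with hN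
  set B : ℝ := 2 * √(Fintype.card K) with hB
  set C : ℝ := ((P.card : ℝ) - 1) / δ + 2 with hC
  have hB0 : 0 ≤ B := by positivity
  let E (f : Additive Kˣ → ℂ) (g : K → ℂ) : ℂ := ∑ β : Kˣ, f (Additive.ofMul β) * g ((β : K) ^ 2)
  let ΛR (f : Additive Kˣ → ℂ) : (K → ℂ) →ₗ[ℂ] ℂ :=
    { toFun := E f
      map_add' := fun g g' => by simp [E, mul_add, Finset.sum_add_distrib]
      map_smul' := fun c g => by
        simp only [E, Finset.mul_sum, Pi.smul_apply, smul_eq_mul, RingHom.id_apply]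
        exact Finset.sum_congr rfl fun _ _ => by ring }
  let ΛL (g : K → ℂ) : (Additive Kˣ → ℂ) →ₗ[ℂ] ℂ :=
    { toFun := fun f => E f g
      map_add' := fun f f' => by simp [E, add_mul, Finset.sum_add_distrib]
      map_smul' := fun c f => by
        simp only [E, Finset.mul_sum, Pi.smul_apply, smul_eq_mul, RingHom.id_apply]
        exact Finset.sum_congr rfl fun _ _ => by ring }
  have hχR : ∀ χ : AddChar (Additive Kˣ) ℂ, ‖E χ R‖ ≤ N * B := by
    intro χ
    refine hR.norm_map_le (ΛR χ) hB0 fun ψ hψ => ?_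
    have := norm_quadraticSum_one_le χ hψ.1
    change ‖E χ ψ‖ ≤ B
    simpa only [E, hB, quadraticSum, one_mul] using this
  -- Every character in `F` is nontrivial, hence sums to zero over `Kˣ`.
  have hF1 : E F 1 = 0 := by
    have h0 := hF.norm_map_le (ΛL 1) le_rfl fun χ hχ => by
      have : ∑ x, χ x = 0 := by
        rw [AddChar.sum_eq_ite, if_neg hχ]
      have h2 : E χ 1 = ∑ x, χ x := by
        simp only [E, Pi.one_apply, mul_one]
        exact Equiv.sum_comp Additive.ofMul (fun x => χ x)
      change ‖E χ 1‖ ≤ 0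
      rw [h2, this, norm_zero]
    rw [mul_zero] at h0
    exact norm_le_zero_iff.1 h0
  -- The constant `δ` cancels the `-δ` in the weight of `F`, leaving `2 ^ L.card * (2 δ + P.card -
  -- 1)`.
  have hFδ : FourierBound Set.univ (2 ^ L.card * (δ * C)) ((δ : ℂ) • 1 + F) := by
    refine (((FourierBound.one (Set.mem_univ 0)).smul _).add
      (hF.mono (Set.subset_univ _) le_rfl)).mono le_rfl (le_of_eq ?_)
    rw [Complex.norm_real, Real.norm_of_nonneg hδ_pos.le, hC]
    field_simp
    ring
  have hER : ‖E ((δ : ℂ) • 1 + F) R‖ ≤ 2 ^ L.card * (δ * C) * (N * B) :=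
    hFδ.norm_map_le (ΛL R) (mul_nonneg hR.nonneg hB0) fun χ _ => hχR χ
  have htot : E ((δ : ℂ) • 1 + F) (1 + R) = ((δ * m : ℝ) : ℂ) + E ((δ : ℂ) • 1 + F) R := by
    have h1 : E ((δ : ℂ) • 1 + F) (1 + R) = E ((δ : ℂ) • 1 + F) 1 + E ((δ : ℂ) • 1 + F) R :=
      (ΛR _).map_add _ _
    have h2 : E ((δ : ℂ) • 1 + F) 1 = E ((δ : ℂ) • 1) 1 + E F 1 := (ΛL _).map_add _ _
    rw [h1, h2, hF1, add_zero]
    congr 1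
    simp [E, hm, mul_comm]
  -- If no `β` works, each one meeting the `L` conditions and the additive ones is an `ℓ`-th power
  -- for some `ℓ ∈ P`, so its sieve factor `1 - ∑ 1_ℓ` is not positive.
  have hneg : (E ((δ : ℂ) • 1 + F) (1 + R)).re ≤ 0 := by
    simp only [E, Complex.re_sum]
    refine Finset.sum_nonpos fun β _ => ?_
    have h1 := hFx (Additive.ofMul β)
    have h2 := hRx ((β : K) ^ 2)
    have h3 : ((κ₁ * κ₂ : ℝ) : ℂ) * ((((δ : ℂ) • 1 + F : Additive Kˣ → ℂ)) (Additive.ofMul β) *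
        ((1 + R : K → ℂ)) ((β : K) ^ 2)) =
        (((if ∀ ℓ ∈ L, Additive.ofMul β ∉
            (nsmulAddMonoidHom ℓ : Additive Kˣ →+ Additive Kˣ).range then 1 else 0) *
          (1 - ∑ ℓ ∈ P, if Additive.ofMul β ∈
            (nsmulAddMonoidHom ℓ : Additive Kˣ →+ Additive Kˣ).range then 1 else 0) *
          (if (β : K) ^ 2 - a ∈ W ∧ ∀ i ∈ t, (β : K) ^ 2 ∉ V i then 1 else 0) : ℝ) : ℂ) := by
      have h5 : ((κ₁ * κ₂ : ℝ) : ℂ) * ((((δ : ℂ) • 1 + F : Additive Kˣ → ℂ)) (Additive.ofMul β) *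
          ((1 + R : K → ℂ)) ((β : K) ^ 2)) =
          (κ₁ * (δ + F (Additive.ofMul β))) * (κ₂ * (1 + R ((β : K) ^ 2))) := by
        simp only [Pi.add_apply, Pi.smul_apply, Pi.one_apply, smul_eq_mul]
        push_cast
        ring
      rw [h5, h1, ← h2]
      simp only [Complex.ofReal_mul, Complex.ofReal_sub, Complex.ofReal_sum,
        apply_ite Complex.ofReal, Complex.ofReal_one, Complex.ofReal_zero]
      congr!
    have h4 := congrArg Complex.re h3
    rw [Complex.re_ofReal_mul, Complex.ofReal_re] at h4
    refine nonpos_of_mul_nonpos_right (a := κ₁ * κ₂) ?_ (mul_pos hκ₁ hκ₂)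
    rw [h4]
    split_ifs with c1 c2 c2
    · rw [one_mul, mul_one, sub_nonpos]
      have c3 : ∃ ℓ ∈ P, Additive.ofMul β ∈
          (nsmulAddMonoidHom ℓ : Additive Kˣ →+ Additive Kˣ).range := by
        by_contra! c4
        obtain ⟨i, hi, hi'⟩ := hcon β (fun ℓ hℓ γ hγ => by
          have hmem : Additive.ofMul β ∈
              (nsmulAddMonoidHom ℓ : Additive Kˣ →+ Additive Kˣ).range :=
            ⟨Additive.ofMul γ, by rw [← hγ]; rfl⟩
          rcases Finset.mem_union.1 hℓ with k | k
          exacts [c1 ℓ k hmem, c4 ℓ k hmem]) c2.1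
        exact c2.2 i hi hi'
      obtain ⟨ℓ, hℓ, hℓ'⟩ := c3
      refine le_trans ?_ (Finset.single_le_sum (fun i _ => ?_) hℓ)
      · rw [if_pos hℓ']
      · split_ifs <;> norm_num
    · simp
    · simp
    · simp
  rw [htot, Complex.add_re, Complex.ofReal_re] at hneg
  have hlow : δ * m ≤ 2 ^ L.card * (δ * C) * (N * B) := by
    have := (abs_le.1 (Complex.abs_re_le_norm (E ((δ : ℂ) • 1 + F) R))).1
    linarith
  have hlow' : m ≤ 2 ^ L.card * C * (N * B) := by
    refine le_of_mul_le_mul_left ?_ hδ_pos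
    linarith
  have hQ : (Fintype.card K : ℝ) = m + 1 := by
    rw [hm, Fintype.card_units, Nat.cast_sub Fintype.card_pos]; simp
  have hC1 : 1 ≤ C := one_le_sieve_constant P δ hδ hδ_pos
  rw [Nat.card_eq_fintype_card] at h
  have hsq := Real.mul_self_sqrt (Nat.cast_nonneg (α := ℝ) (Fintype.card K))
  have hr1 : 1 ≤ √(Fintype.card K : ℝ) := by
    rw [Real.one_le_sqrt]
    exact_mod_cast Fintype.card_pos
  have hp : (1 : ℝ) ≤ 2 ^ L.card := one_le_pow₀ (by norm_num)
  have hpC : 1 ≤ 2 ^ L.card * C := one_le_mul_of_one_le_of_one_le hp hC1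
  set r := √(Fintype.card K : ℝ)
  -- The `-1` in `N` leaves a spare `2 * 2 ^ L.card * C * r`, which exceeds the difference `1`
  -- between `|K| = r²` and `m = |Kˣ|`.
  have h5 : 2 * (2 ^ L.card * C) * (N + 1) < r := by
    rw [hN]
    linarith
  have h6 := mul_lt_mul_of_pos_right h5 (by linarith : 0 < r)
  have h7 : 1 ≤ (2 ^ L.card * C) * r := one_le_mul_of_one_le_of_one_le hpC hr1
  rw [hB] at hlow'
  nlinarith

end Sieve

/-! ### `K` as a cyclic `F[X]`-module under Frobenius -/

section FrobeniusModule

open Polynomial Module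

variable {F : Type u} {K : Type v} [Field F] [Fintype F] [Field K] [Finite K] [Algebra F K]

variable (F K) in
/-- The action of a polynomial over `F` on `K`, where `X` acts as the `F`-linear Frobenius map. -/
noncomputable def frobEval : F[X] →ₐ[F] Module.End F K :=
  aeval (FiniteField.frobeniusAlgHom F K).toLinearMap

omit [Finite K] in
lemma frobEval_X_pow (i : ℕ) (x : K) : frobEval F K (X ^ i) x = x ^ (Nat.card F ^ i) := by
  induction i generalizing x with
  | zero => simp [frobEval]
  | succ i ih =>
    rw [pow_succ, map_mul, Module.End.mul_apply, ih]
    simp only [frobEval, aeval_X, AlgHom.toLinearMap_apply, FiniteField.coe_frobeniusAlgHom,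
      Nat.card_eq_fintype_card]
    rw [← pow_mul, pow_succ']

lemma frobEval_X_pow_finrank_sub_one : frobEval F K (X ^ finrank F K - 1) = 0 := by
  rw [← FiniteField.minpoly_frobeniusAlgHom F K, frobEval, minpoly.aeval]

/-- If `P` acted surjectively, the cofactor of `P` in `X ^ n - 1` would kill `K`, although `X ^ n -
1` is the minimal polynomial of Frobenius. -/
lemma range_frobEval_ne_top {P : F[X]} (hP : P ∣ X ^ finrank F K - 1) (hirr : Irreducible P) :
    LinearMap.range (frobEval F K P) ≠ ⊤ := by
  intro htop
  obtain ⟨Q, hQ⟩ := hP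
  have hpos : 0 < finrank F K := finrank_pos
  have hne : (X ^ finrank F K - 1 : F[X]) ≠ 0 := X_pow_sub_C_ne_zero hpos 1
  have hQ0 : Q ≠ 0 := by
    rintro rfl
    exact hne (by rw [hQ, mul_zero])
  have h0 : frobEval F K Q = 0 := by
    ext x
    obtain ⟨y, rfl⟩ := LinearMap.range_eq_top.1 htop x
    rw [← Module.End.mul_apply, ← map_mul, mul_comm, ← hQ, frobEval_X_pow_finrank_sub_one]
    rfl
  have h1 := minpoly.dvd F _ (show aeval _ Q = 0 from h0)
  rw [FiniteField.minpoly_frobeniusAlgHom, hQ] at h1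
  have h2 := natDegree_le_of_dvd h1 hQ0
  rw [natDegree_mul hirr.ne_zero hQ0] at h2
  have := hirr.natDegree_pos
  omega

variable (F) in
/-- The span of the conjugates of `α` consists of the values at `α` of the polynomials in the
Frobenius map. -/
lemma mem_span_conjugates (α x : K) :
    x ∈ Submodule.span F (Set.range fun i : Fin (finrank F K) => α ^ (Nat.card F ^ (i : ℕ))) ↔
      ∃ g : F[X], frobEval F K g α = x := by
  constructor
  · intro hx
    have : Submodule.span F
        (Set.range fun i : Fin (finrank F K) => α ^ (Nat.card F ^ (i : ℕ))) ≤
        LinearMap.range ((LinearMap.applyₗ α).comp (frobEval F K).toLinearMap) := by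
      rw [Submodule.span_le]
      rintro _ ⟨i, rfl⟩
      exact ⟨X ^ (i : ℕ), frobEval_X_pow _ _⟩
    obtain ⟨g, hg⟩ := this hx
    exact ⟨g, hg⟩
  · rintro ⟨g, rfl⟩
    have hpos : 0 < finrank F K := finrank_pos
    have hmon : (X ^ finrank F K - 1 : F[X]).Monic := monic_X_pow_sub_C 1 hpos.ne'
    have hdeg : (X ^ finrank F K - 1 : F[X]).natDegree = finrank F K := natDegree_X_pow_sub_C
    -- Reduction modulo `X ^ n - 1` leaves only the exponents below `n`.
    have h1 : frobEval F K g α = frobEval F K (g %ₘ (X ^ finrank F K - 1)) α := by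
      conv_lhs => rw [← modByMonic_add_div g (X ^ finrank F K - 1)]
      rw [map_add, map_mul, frobEval_X_pow_finrank_sub_one, zero_mul, add_zero]
    have h2 : (g %ₘ (X ^ finrank F K - 1)).natDegree < finrank F K := by
      have := natDegree_modByMonic_lt g hmon (by
        intro h
        rw [h, natDegree_one] at hdeg
        omega)
      rwa [hdeg] at this
    rw [h1, as_sum_range' _ _ h2, map_sum, LinearMap.sum_apply]
    refine Submodule.sum_mem _ fun i hi => ?_
    rw [← C_mul_X_pow_eq_monomial, ← smul_eq_C_mul, map_smul, LinearMap.smul_apply,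
      frobEval_X_pow]
    exact Submodule.smul_mem _ _ (Submodule.subset_span ⟨⟨i, Finset.mem_range.1 hi⟩, rfl⟩)

variable (F K) in
lemma exists_frobEval_surjective : ∃ θ : K, ∀ x, ∃ g : F[X], frobEval F K g θ = x := by
  let b := IsGalois.normalBasis F K
  refine ⟨b 1, fun x => ?_⟩
  have h : (⊤ : Submodule F K) ≤
      LinearMap.range ((LinearMap.applyₗ (b 1)).comp (frobEval F K).toLinearMap) := by
    rw [← b.span_eq, Submodule.span_le]
    rintro _ ⟨τ, rfl⟩
    obtain ⟨i, rfl⟩ := (FiniteField.bijective_frobeniusAlgEquivOfAlgebraic_pow F K).2 τ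
    refine ⟨X ^ (i : ℕ), (frobEval_X_pow _ _).trans ?_⟩
    change _ = IsGalois.normalBasis F K _
    rw [IsGalois.normalBasis_apply (e := FiniteField.frobeniusAlgEquivOfAlgebraic F K ^ (i : ℕ)),
      AlgEquiv.coe_pow, FiniteField.coe_frobeniusAlgEquivOfAlgebraic_iterate,
      Nat.card_eq_fintype_card]
  obtain ⟨g, hg⟩ := h (Submodule.mem_top (x := x))
  exact ⟨g, hg⟩

lemma isNormalElement_of_isCoprime {θ : K} (hθ : ∀ x, ∃ g : F[X], frobEval F K g θ = x) {g : F[X]}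
    (hg : IsCoprime g (X ^ finrank F K - 1)) : IsNormalElement F (frobEval F K g θ) := by
  have hspan : Submodule.span F (Set.range fun i : Fin (finrank F K) =>
      (frobEval F K g θ) ^ (Nat.card F ^ (i : ℕ))) = ⊤ := by
    rw [eq_top_iff]
    intro x _
    obtain ⟨f, rfl⟩ := hθ x
    obtain ⟨a, b, hab⟩ := hg
    refine (mem_span_conjugates F _ _).2 ⟨f * a, ?_⟩
    have : f * a * g = f - f * b * (X ^ finrank F K - 1) := by linear_combination f * hab
    rw [← Module.End.mul_apply, ← map_mul, this, map_sub, map_mul _ (f * b),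
      frobEval_X_pow_finrank_sub_one, mul_zero, sub_zero]
  exact ⟨linearIndependent_of_top_le_span_of_card_eq_finrank hspan.ge (by simp), hspan⟩

omit [Finite K] in
lemma frobEval_X_sub_one_apply (x : K) : frobEval F K (X - 1) x = x ^ Fintype.card F - x := by
  simp [frobEval]

lemma finrank_range_frobEval_X_sub_one :
    finrank F (LinearMap.range (frobEval F K (X - 1))) + 1 = finrank F K := by
  have hker : LinearMap.ker (frobEval F K (X - 1)) = 1 := by
    ext x
    rw [LinearMap.mem_ker, frobEval_X_sub_one_apply, sub_eq_zero, Submodule.mem_one]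
    constructor
    · intro hx
      have h : x ∈ Set.range (algebraMap F K) := by
        rw [IsGalois.mem_range_algebraMap_iff_fixed]
        intro τ
        obtain ⟨i, rfl⟩ := (FiniteField.bijective_frobeniusAlgEquivOfAlgebraic_pow F K).2 τ
        change (FiniteField.frobeniusAlgEquivOfAlgebraic F K ^ (i : ℕ)) x = x
        rw [AlgEquiv.coe_pow]
        exact Function.iterate_fixed hx _
      exact h
    · rintro ⟨y, rfl⟩
      rw [← map_pow, FiniteField.pow_card]
  have h1 := LinearMap.finrank_range_add_finrank_ker (frobEval F K (X - 1))
  rwa [hker, Submodule.one_eq_span, finrank_span_singleton one_ne_zero] at h1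

/-- The two hypotheses say that `X - 1` is a gcd of `g` and `X ^ n - 1`. The conjugates of `g θ`
then span the image of `X - 1`, whose kernel is the line `F`. -/
lemma isKNormal_one_of_gcd {θ : K} (hθ : ∀ x, ∃ g : F[X], frobEval F K g θ = x) {g : F[X]}
    (hdvd : X - 1 ∣ g) (hg : ∃ a b : F[X], a * g + b * (X ^ finrank F K - 1) = X - 1) :
    IsKNormal F 1 (frobEval F K g θ) := by
  have hspan : Submodule.span F (Set.range fun i : Fin (finrank F K) =>
      (frobEval F K g θ) ^ (Nat.card F ^ (i : ℕ))) = LinearMap.range (frobEval F K (X - 1)) := by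
    ext x
    rw [mem_span_conjugates, LinearMap.mem_range]
    constructor
    · rintro ⟨f, rfl⟩
      obtain ⟨c, rfl⟩ := hdvd
      refine ⟨frobEval F K (f * c) θ, ?_⟩
      rw [← Module.End.mul_apply, ← Module.End.mul_apply, ← map_mul, ← map_mul]
      congr 2
      ring
    · rintro ⟨y, rfl⟩
      obtain ⟨f, rfl⟩ := hθ y
      obtain ⟨a, b, hab⟩ := hg
      refine ⟨f * a, ?_⟩
      have : f * a * g = (X - 1) * f - f * b * (X ^ finrank F K - 1) := by
        linear_combination f * hab
      rw [← Module.End.mul_apply, ← map_mul, this, map_sub, map_mul _ (f * b),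
        frobEval_X_pow_finrank_sub_one, mul_zero, sub_zero, map_mul, Module.End.mul_apply]
  rw [IsKNormal, hspan, finrank_range_frobEval_X_sub_one]

/-- The index of the image is the order of the kernel, which consists of roots of `X ^ (q ^ d) - X`.
-/
lemma index_range_frobEval_le {d : ℕ} (hd : 0 < d) :
    (LinearMap.range (frobEval F K (X ^ d - 1))).toAddSubgroup.index ≤ Nat.card F ^ d := by
  classical
  have := Fintype.ofFinite K
  have h1 : (LinearMap.range (frobEval F K (X ^ d - 1))).toAddSubgroup.index =
      Nat.card (frobEval F K (X ^ d - 1)).toAddMonoidHom.ker :=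
    AddSubgroup.index_range (f := (frobEval F K (X ^ d - 1)).toAddMonoidHom)
  have hq : 1 < Nat.card F ^ d := Nat.one_lt_pow hd.ne' Finite.one_lt_card
  rw [h1]
  have hne : (X ^ (Nat.card F ^ d) - X : K[X]) ≠ 0 := FiniteField.X_pow_card_sub_X_ne_zero K hq
  calc Nat.card (frobEval F K (X ^ d - 1)).toAddMonoidHom.ker
      ≤ Nat.card ((X ^ (Nat.card F ^ d) - X : K[X]).roots.toFinset) := by
        refine Nat.card_mono (Finset.finite_toSet _) fun x hx => ?_
        have hx' : frobEval F K (X ^ d - 1) x = 0 := hx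
        rw [map_sub, LinearMap.sub_apply, frobEval_X_pow, map_one, Module.End.one_apply] at hx'
        simpa [-Nat.card_eq_fintype_card, hne] using hx'
    _ ≤ _ := by
        rw [Nat.card_eq_fintype_card, Fintype.card_coe]
        refine (Multiset.toFinset_card_le _).trans ((card_roots' _).trans ?_)
        rw [FiniteField.X_pow_card_sub_X_natDegree_eq K hq]

omit [Finite K] in
-- Polynomial analogue of `sup_inf_range_nsmul_eq_top`: Bézout for `P` and `h * ∏ Q`.
lemma sup_range_frobEval_eq_top (h : F[X]) (s : Finset F[X]) (P : F[X]) (hPh : IsCoprime P h)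
    (hPs : ∀ Q ∈ s, IsCoprime P Q) :
    (LinearMap.range (frobEval F K P)).toAddSubgroup ⊔
      ((LinearMap.range (frobEval F K h)).toAddSubgroup ⊓
        s.inf fun Q => (LinearMap.range (frobEval F K Q)).toAddSubgroup) = ⊤ := by
  rw [eq_top_iff]
  intro x _
  have hc : IsCoprime P (h * ∏ Q ∈ s, Q) := hPh.mul_right (IsCoprime.prod_right hPs)
  obtain ⟨a, b, hab⟩ := hc
  have hx : x = frobEval F K (P * a) x + frobEval F K (h * (∏ Q ∈ s, Q) * b) x := by
    rw [← LinearMap.add_apply, ← map_add, mul_comm P, mul_comm _ b, hab, map_one]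
    rfl
  have key : ∀ A B : F[X], A ∣ B →
      frobEval F K B x ∈ (LinearMap.range (frobEval F K A)).toAddSubgroup := by
    rintro A _ ⟨c, rfl⟩
    exact ⟨frobEval F K c x, by rw [map_mul]; rfl⟩
  rw [hx]
  refine AddSubgroup.add_mem_sup (key _ _ (dvd_mul_right _ _)) ⟨key _ _ ⟨_, mul_assoc _ _ _⟩, ?_⟩
  have hle : AddSubgroup.zmultiples (frobEval F K (h * (∏ Q ∈ s, Q) * b) x) ≤
      s.inf fun Q => (LinearMap.range (frobEval F K Q)).toAddSubgroup :=
    Finset.le_inf fun Q hQ => AddSubgroup.zmultiples_le_of_mem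
      (key _ _ (((Finset.dvd_prod_of_mem (fun Q => Q) hQ).mul_left _).mul_right _))
  exact hle (AddSubgroup.mem_zmultiples _)

end FrobeniusModule

/-! ### Lower bounds for the divisor counts `W` -/

section Counting

open Polynomial UniqueFactorizationMonoid

/-- Products over distinct subsets are distinct, since a prime dividing such a product is one of its
factors. Finiteness of `A` is essential because `ncard` is zero on infinite sets. -/
lemma two_pow_card_le_ncard {R : Type*} [CommMonoidWithZero R] (s : Finset R)
    (hs : ∀ p ∈ s, Prime p) (hrel : ∀ p ∈ s, ∀ r ∈ s, p ∣ r → p = r) (A : Set R) (hA : A.Finite)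
    (h : ∀ t ⊆ s, ∏ p ∈ t, p ∈ A) : 2 ^ s.card ≤ A.ncard := by
  rw [← Finset.card_powerset, ← Set.ncard_coe_finset]
  refine Set.ncard_le_ncard_of_injOn (fun t => ∏ p ∈ t, p)
    (fun t ht => h t (Finset.mem_powerset.1 ht)) ?_ hA
  have key : ∀ t ⊆ s, ∀ t' ⊆ s, ∏ p ∈ t, p = ∏ p ∈ t', p → t ⊆ t' := by
    intro t ht t' ht' heq p hp
    have hdvd : p ∣ ∏ p ∈ t', p := heq ▸ Finset.dvd_prod_of_mem (fun p => p) hp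
    obtain ⟨r, hr, hpr⟩ := (hs p (ht hp)).exists_mem_finset_dvd hdvd
    rwa [hrel p (ht hp) r (ht' hr) hpr]
  intro t ht t' ht' heq
  have ht := Finset.mem_powerset.1 ht
  have ht' := Finset.mem_powerset.1 ht'
  exact (key t ht t' ht' heq).antisymm (key t' ht' t ht heq.symm)

lemma two_pow_card_le_natW (L : Finset ℕ) (hL : ∀ ℓ ∈ L, ℓ.Prime) :
    2 ^ L.card ≤ natW (∏ ℓ ∈ L, ℓ) := by
  have h0 : ∏ ℓ ∈ L, ℓ ≠ 0 := Finset.prod_ne_zero_iff.2 fun ℓ hℓ => (hL ℓ hℓ).ne_zero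
  refine two_pow_card_le_ncard L (fun ℓ hℓ => (hL ℓ hℓ).prime)
    (fun ℓ hℓ m hm h => (Nat.prime_dvd_prime_iff_eq (hL ℓ hℓ) (hL m hm)).1 h) _
    ((Nat.divisors _).finite_toSet.subset fun d hd => Nat.mem_divisors.2 ⟨hd.2, h0⟩)
    fun t ht => ⟨?_, Finset.prod_dvd_prod_of_subset t L _ ht⟩
  refine Finset.squarefree_prod_of_pairwise_isCoprime (fun ℓ hℓ m hm hne => ?_)
    fun ℓ hℓ => (hL ℓ (ht hℓ)).prime.squarefree
  exact Nat.coprime_iff_isRelPrime.1 ((Nat.coprime_primes (hL ℓ (ht hℓ)) (hL m (ht hm))).2 hne)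

variable {F : Type u} [Field F]

lemma mem_primeFactors_iff [DecidableEq F] {f : F[X]} (hf : f ≠ 0) {P : F[X]} :
    P ∈ primeFactors f ↔ Irreducible P ∧ P.Monic ∧ P ∣ f := by
  rw [mem_primeFactors, mem_normalizedFactors_iff' hf]
  refine and_congr_right fun hP => and_congr_left fun _ => ?_
  exact ⟨fun h => h ▸ monic_normalize hP.ne_zero, fun h => h.normalize_eq_self⟩

lemma eq_of_irreducible_dvd {P Q : F[X]} (hP : Irreducible P) (hPm : P.Monic) (hQ : Irreducible Q)
    (hQm : Q.Monic) (h : P ∣ Q) : P = Q :=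
  eq_of_monic_of_associated hPm hQm (hP.associated_of_dvd hQ h)

lemma finite_setOf_dvd [Finite F] {f : F[X]} (hf : f ≠ 0) : {D : F[X] | D ∣ f}.Finite := by
  have : Finite (degreeLT F (f.natDegree + 1)) := Module.finite_of_finite F
  refine (Set.toFinite (degreeLT F (f.natDegree + 1) : Set F[X])).subset fun D hD => ?_
  rw [SetLike.mem_coe, mem_degreeLT]
  refine lt_of_le_of_lt degree_le_natDegree ?_
  exact_mod_cast Nat.lt_succ_of_le (natDegree_le_of_dvd hD hf)

lemma two_pow_card_primeFactors_le_polyW [Finite F] [DecidableEq F] {f : F[X]} (hf : f ≠ 0) :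
    2 ^ (primeFactors f).card ≤ polyW f := by
  have hmem := fun P hP => (mem_primeFactors_iff hf (P := P)).1 hP
  refine two_pow_card_le_ncard (primeFactors f) (fun P hP => (hmem P hP).1.prime)
    (fun P hP Q hQ h => eq_of_irreducible_dvd (hmem P hP).1 (hmem P hP).2.1 (hmem Q hQ).1
      (hmem Q hQ).2.1 h) _
    ((finite_setOf_dvd hf).subset fun d hd => hd.2.2) fun t ht => ⟨?_, ?_, ?_⟩
  · exact monic_prod_of_monic _ _ fun P hP => (hmem P (ht hP)).2.1
  · refine Finset.squarefree_prod_of_pairwise_isCoprime (fun P hP Q hQ hne => ?_)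
      fun P hP => (hmem P (ht hP)).1.squarefree
    refine ((hmem P (ht hP)).1.isRelPrime_iff_not_dvd).2 fun h => hne ?_
    exact eq_of_irreducible_dvd (hmem P (ht hP)).1 (hmem P (ht hP)).2.1 (hmem Q (ht hQ)).1
      (hmem Q (ht hQ)).2.1 h
  · exact (Finset.prod_dvd_prod_of_subset t _ _ ht).trans (radical_dvd_self (a := f))

end Counting

/-! ### From generators to `2`-primitive elements -/

section Primitive

/-- For a generator `g`, a prime dividing both `a` and the group order would make `g ^ a` an `ℓ`-th
power. -/
lemma orderOf_eq_card_of_forall_pow_ne {G : Type*} [CommGroup G] [Finite G] [IsCyclic G] (β : G)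
    (h : ∀ ℓ : ℕ, ℓ.Prime → ℓ ∣ Nat.card G → ∀ γ : G, γ ^ ℓ ≠ β) : orderOf β = Nat.card G := by
  obtain ⟨g, hg⟩ := IsCyclic.exists_monoid_generator (α := G)
  obtain ⟨a, rfl⟩ := Submonoid.mem_powers_iff _ _ |>.1 (hg β)
  have hcop : (Nat.card G).Coprime a := by
    refine Nat.coprime_of_dvd fun ℓ hℓ h1 ⟨b, hb⟩ => h ℓ hℓ h1 (g ^ b) ?_
    rw [← pow_mul, hb, mul_comm]
  have hord : orderOf g = Nat.card G :=
    orderOf_eq_card_of_forall_mem_powers hg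
  rw [orderOf_pow, hord, hcop.gcd_eq_one, Nat.div_one]

/-- A `2`-primitive element in a coset of `W` that avoids the independent subgroups `V i`. -/
theorem exists_isRPrimitive_two_avoid {K : Type u} [Field K] [Finite K] {ι : Type v}
    (hodd : 2 ∣ Nat.card K - 1) (L P : Finset ℕ)
    (hL : L ∪ P = (Nat.card K - 1).primeFactors) (hLP : Disjoint L P) (δ : ℝ)
    (hδ : δ = 1 - ∑ ℓ ∈ P, (ℓ : ℝ)⁻¹) (hδ_pos : 0 < δ)
    (W : AddSubgroup K) (a : K) (V : ι → AddSubgroup K) (t : Finset ι)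
    (hV : ∀ i ∈ t, V i ≠ ⊤)
    (hind : ∀ s ⊆ t, ∀ i ∈ t, i ∉ s → V i ⊔ (W ⊓ s.inf V) = ⊤)
    (h : 2 * 2 ^ L.card * (W.index * 2 ^ t.card) * (((P.card : ℝ) - 1) / δ + 2) <
      √(Nat.card K)) :
    ∃ α : K, IsRPrimitive 2 α ∧ α - a ∈ W ∧ ∀ i ∈ t, α ∉ V i := by
  classical
  have hmem : ∀ ℓ ∈ L ∪ P, ℓ.Prime ∧ ℓ ∣ Nat.card K - 1 := by
    intro ℓ hℓ
    rw [hL] at hℓ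
    exact ⟨Nat.prime_of_mem_primeFactors hℓ, Nat.dvd_of_mem_primeFactors hℓ⟩
  obtain ⟨β, h1, h2, h3⟩ := exists_unit_sq_avoid L P
    (fun ℓ hℓ => hmem ℓ (Finset.mem_union_left _ hℓ))
    (fun ℓ hℓ => hmem ℓ (Finset.mem_union_right _ hℓ)) hLP δ hδ hδ_pos W a V t hV hind h
  refine ⟨(β : K) ^ 2, ⟨pow_ne_zero _ β.ne_zero, hodd, ?_⟩, h2, h3⟩
  have hcard : Nat.card Kˣ = Nat.card K - 1 := Nat.card_units K
  have hord : orderOf β = Nat.card K - 1 := by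
    rw [← hcard]
    refine orderOf_eq_card_of_forall_pow_ne β fun ℓ hℓ hdvd => h1 ℓ ?_
    rw [hL, Nat.mem_primeFactors]
    exact ⟨hℓ, hcard ▸ hdvd, hcard ▸ Nat.card_pos.ne'⟩
  rw [← Units.val_pow_eq_pow_val, orderOf_units, orderOf_pow, hord, Nat.gcd_eq_right hodd]

end Primitive

/-! ### Normal and `1`-normal elements -/

section Main

open Polynomial UniqueFactorizationMonoid Module

variable {F : Type u} {K : Type v} [Field F] [Fintype F] [Field K] [Finite K] [Algebra F K]

open Classical in
/-- Sieve for `2`-primitive elements `α` in a coset of the image of `h` under `frobEval`, such that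
`α` is not in the image of any polynomial of `t`. -/
lemma exists_isRPrimitive_two_frobEval (hodd : 2 ∣ Nat.card K - 1) (P : Finset ℕ)
    (hP : P ⊆ (Nat.card K - 1).primeFactors) (δ : ℝ)
    (hδ : δ = 1 - ∑ ℓ ∈ P, (ℓ : ℝ)⁻¹) (hδ_pos : 0 < δ) (h : F[X]) (a : K) (t : Finset F[X])
    (ht : ∀ Q ∈ t, Irreducible Q ∧ Q.Monic ∧ Q ∣ X ^ finrank F K - 1 ∧ IsCoprime Q h)
    (hlt : natW (∏ ℓ ∈ (Nat.card K - 1).primeFactors \ P, ℓ) *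
      ((LinearMap.range (frobEval F K h)).toAddSubgroup.index * (2 * 2 ^ t.card)) *
      (((P.card : ℝ) - 1) / δ + 2) < √(Nat.card K)) :
    ∃ α : K, IsRPrimitive 2 α ∧ (∃ x, α = a + frobEval F K h x) ∧
      ∀ Q ∈ t, ∀ x, frobEval F K Q x ≠ α := by
  set L := (Nat.card K - 1).primeFactors \ P with hLdef
  have hC := one_le_sieve_constant P δ hδ hδ_pos
  have hW : (2 : ℝ) ^ L.card ≤ natW (∏ ℓ ∈ L, ℓ) := by
    exact_mod_cast two_pow_card_le_natW L fun ℓ hℓ =>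
      Nat.prime_of_mem_primeFactors (Finset.mem_sdiff.1 hℓ).1
  obtain ⟨α, h1, ⟨x, hx⟩, h3⟩ := exists_isRPrimitive_two_avoid hodd L P
    (Finset.sdiff_union_of_subset hP) Finset.sdiff_disjoint δ hδ hδ_pos
    (LinearMap.range (frobEval F K h)).toAddSubgroup a
    (fun Q => (LinearMap.range (frobEval F K Q)).toAddSubgroup) t
    (fun Q hQ hT => range_frobEval_ne_top (ht Q hQ).2.2.1 (ht Q hQ).1
      (Submodule.toAddSubgroup_injective hT))
    (fun s hs Q hQ hQs => sup_range_frobEval_eq_top h s Q (ht Q hQ).2.2.2 fun R hR => by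
      refine ((ht Q hQ).1.coprime_iff_not_dvd).2 fun hdvd => hQs ?_
      rwa [eq_of_irreducible_dvd (ht Q hQ).1 (ht Q hQ).2.1 (ht R (hs hR)).1 (ht R (hs hR)).2.1
        hdvd])
    (by
      refine lt_of_le_of_lt ?_ hlt
      rw [mul_comm (2 : ℝ), mul_assoc (2 ^ L.card : ℝ), mul_left_comm (2 : ℝ)]
      gcongr)
  exact ⟨α, h1, ⟨x, by rw [hx]; ring⟩, fun Q hQ x hx => h3 Q hQ ⟨x, hx⟩⟩

omit [Fintype F] [Finite K] in
lemma X_pow_finrank_sub_one_eq {p k u : ℕ} [CharP F p] (hp : p.Prime)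
    (hn : finrank F K = p ^ k * u) : (X ^ finrank F K - 1 : F[X]) = (X ^ u - 1) ^ p ^ k := by
  have : Fact p.Prime := ⟨hp⟩
  rw [hn, sub_pow_char_pow, one_pow, ← pow_mul, mul_comm]

omit [Finite K] in
-- A common irreducible factor `Q` of `g` and `f` would put `g θ` in the image of `Q`.
lemma isCoprime_of_forall_primeFactors [DecidableEq F] {θ : K} {f g : F[X]} (hf : f ≠ 0)
    (h : ∀ Q ∈ primeFactors f, ∀ x, frobEval F K Q x ≠ frobEval F K g θ) : IsCoprime g f := by
  refine isCoprime_of_irreducible_dvd (fun h0 => hf h0.2) fun Q hQ hQg hQf => ?_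
  have hQ' : normalize Q ∣ g := normalize_dvd_iff.2 hQg
  obtain ⟨c, rfl⟩ := hQ'
  refine h (normalize Q) ((mem_primeFactors_iff hf).2
    ⟨(normalize_associated Q).symm.irreducible hQ, monic_normalize hQ.ne_zero,
      normalize_dvd_iff.2 hQf⟩) (frobEval F K c θ) ?_
  rw [map_mul]
  rfl

/-- Existence of `2`-primitive normal elements. -/
theorem exists_isNormalElement_isRPrimitive {p k u : ℕ} [CharP F p] (hp : p.Prime)
    (hn : finrank F K = p ^ k * u) (hodd : 2 ∣ Nat.card K - 1) (P : Finset ℕ)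
    (hP : P ⊆ (Nat.card K - 1).primeFactors) (δ : ℝ)
    (hδ : δ = 1 - ∑ ℓ ∈ P, (ℓ : ℝ)⁻¹) (hδ_pos : 0 < δ)
    (hlt : 2 * natW (∏ ℓ ∈ (Nat.card K - 1).primeFactors \ P, ℓ) *
      polyW (X ^ u - 1 : F[X]) * (((P.card : ℝ) - 1) / δ + 2) < √(Nat.card K)) :
    ∃ α : K, IsNormalElement F α ∧ IsRPrimitive 2 α := by
  classical
  have hu : 0 < u := by
    have : 0 < finrank F K := finrank_pos
    rw [hn] at this
    exact Nat.pos_of_mul_pos_left this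
  have hf : (X ^ u - 1 : F[X]) ≠ 0 := X_pow_sub_C_ne_zero hu 1
  have hX := X_pow_finrank_sub_one_eq (F := F) (K := K) hp hn
  have hpk : p ^ k ≠ 0 := pow_ne_zero _ hp.ne_zero
  have hC := one_le_sieve_constant P δ hδ hδ_pos
  have hW : (2 : ℝ) ^ (primeFactors (X ^ u - 1 : F[X])).card ≤ polyW (X ^ u - 1 : F[X]) := by
    exact_mod_cast two_pow_card_primeFactors_le_polyW hf
  obtain ⟨θ, hθ⟩ := exists_frobEval_surjective F K
  -- With `h = 1` the coset is all of `K`, of index one.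
  obtain ⟨α, h1, -, h3⟩ := exists_isRPrimitive_two_frobEval (F := F) hodd P hP δ hδ hδ_pos 1 0
    (primeFactors (X ^ u - 1 : F[X]))
    (fun Q hQ => by
      obtain ⟨k1, k2, k3⟩ := (mem_primeFactors_iff hf).1 hQ
      exact ⟨k1, k2, hX ▸ dvd_pow k3 hpk, isCoprime_one_right⟩)
    (by
      refine lt_of_le_of_lt ?_ hlt
      have htop : LinearMap.range (frobEval F K 1) = ⊤ := by
        rw [map_one]; exact LinearMap.range_id
      have htop' : (⊤ : Submodule F K).toAddSubgroup = ⊤ := rfl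
      rw [htop, htop', AddSubgroup.index_top, Nat.cast_one, one_mul, mul_left_comm, ← mul_assoc]
      gcongr)
  obtain ⟨g, rfl⟩ := hθ α
  refine ⟨_, isNormalElement_of_isCoprime hθ ?_, h1⟩
  rw [hX]
  exact (isCoprime_of_forall_primeFactors hf h3).pow_right

/-- Existence of `2`-primitive `1`-normal elements. -/
theorem exists_isKNormal_one_isRPrimitive {p k u : ℕ} [CharP F p] (hp : p.Prime)
    (hn : finrank F K = p ^ k * u) (hu : u.gcd p = 1) (hodd : 2 ∣ Nat.card K - 1) (P : Finset ℕ)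
    (hP : P ⊆ (Nat.card K - 1).primeFactors) (δ : ℝ)
    (hδ : δ = 1 - ∑ ℓ ∈ P, (ℓ : ℝ)⁻¹) (hδ_pos : 0 < δ)
    (hlt : natW (∏ ℓ ∈ (Nat.card K - 1).primeFactors \ P, ℓ) *
      (Nat.card F ^ p ^ k * polyW (X ^ u - 1 : F[X])) * (((P.card : ℝ) - 1) / δ + 2) <
        √(Nat.card K)) :
    ∃ α : K, IsKNormal F 1 α ∧ IsRPrimitive 2 α := by
  classical
  have hu0 : 0 < u := by
    have : 0 < finrank F K := finrank_pos
    rw [hn] at this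
    exact Nat.pos_of_mul_pos_left this
  have hf : (X ^ u - 1 : F[X]) ≠ 0 := X_pow_sub_C_ne_zero hu0 1
  have hX := X_pow_finrank_sub_one_eq (F := F) (K := K) hp hn
  have hpk : p ^ k ≠ 0 := pow_ne_zero _ hp.ne_zero
  have hfact : Fact p.Prime := ⟨hp⟩
  have hC := one_le_sieve_constant P δ hδ hδ_pos
  have hW : (2 : ℝ) ^ (primeFactors (X ^ u - 1 : F[X])).card ≤ polyW (X ^ u - 1 : F[X]) := by
    exact_mod_cast two_pow_card_primeFactors_le_polyW hf
  have hirr : Irreducible (X - 1 : F[X]) := by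
    simpa using irreducible_X_sub_C (1 : F)
  have hmon : (X - 1 : F[X]).Monic := by
    simpa using monic_X_sub_C (1 : F)
  have hdvd : (X - 1 : F[X]) ∣ X ^ u - 1 := by
    simpa using sub_dvd_pow_sub_pow (X : F[X]) 1 u
  -- As `p` does not divide `u`, the factor `X - 1` occurs once in `X ^ u - 1` and is prime to the
  -- cofactor `f'`.
  have hsep : (X ^ u - 1 : F[X]).Separable := by
    rw [X_pow_sub_one_separable_iff, Ne, CharP.cast_eq_zero_iff F p]
    intro h
    exact hp.one_lt.ne' ((Nat.gcd_eq_right h).symm.trans hu)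
  have hmem1 : (X - 1 : F[X]) ∈ primeFactors (X ^ u - 1 : F[X]) :=
    (mem_primeFactors_iff hf).2 ⟨hirr, hmon, hdvd⟩
  set t := (primeFactors (X ^ u - 1 : F[X])).erase (X - 1) with htdef
  -- Dropping `X - 1` from the factors to avoid absorbs the factor `2` of the character sum.
  have htcard : 2 * (2 : ℝ) ^ t.card = 2 ^ (primeFactors (X ^ u - 1 : F[X])).card := by
    rw [← Finset.card_erase_add_one hmem1, pow_succ']
  obtain ⟨f', hf'⟩ := hdvd
  have hf'0 : f' ≠ 0 := by
    rintro rfl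
    exact hf (by rw [hf', mul_zero])
  have hcop' : IsCoprime (X - 1) f' := (hf' ▸ hsep).isCoprime
  have hpow : (X ^ p ^ k - 1 : F[X]) = (X - 1) ^ p ^ k := by
    rw [sub_pow_char_pow, one_pow]
  obtain ⟨θ, hθ⟩ := exists_frobEval_surjective F K
  -- The coset `(X - 1) θ + (X - 1) ^ p ^ k K` fixes the `X - 1` part of the gcd: for `g = X - 1 +
  -- (X - 1) ^ p ^ k * r`, the gcd of `g` and `(X - 1) ^ p ^ k` is `X - 1`.
  obtain ⟨α, h1, ⟨y, hy⟩, h3⟩ := exists_isRPrimitive_two_frobEval (F := F) hodd P hP δ hδ hδ_pos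
    (X ^ p ^ k - 1) (frobEval F K (X - 1) θ) t
    (fun Q hQ => by
      obtain ⟨k0, hQ⟩ := Finset.mem_erase.1 hQ
      obtain ⟨k1, k2, k3⟩ := (mem_primeFactors_iff hf).1 hQ
      refine ⟨k1, k2, hX ▸ dvd_pow k3 hpk, ?_⟩
      rw [hpow]
      refine IsCoprime.pow_right (k1.coprime_iff_not_dvd.2 fun h => k0 ?_)
      exact eq_of_irreducible_dvd k1 k2 hirr hmon h)
    (by
      refine lt_of_le_of_lt ?_ hlt
      rw [htcard]
      have := index_range_frobEval_le (F := F) (K := K) (Nat.pos_of_ne_zero hpk)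
      have : ((LinearMap.range (frobEval F K (X ^ p ^ k - 1))).toAddSubgroup.index : ℝ) ≤
        Nat.card F ^ p ^ k := by exact_mod_cast this
      gcongr)
  obtain ⟨r, rfl⟩ := hθ y
  have hα : α = frobEval F K (X - 1 + (X - 1) ^ p ^ k * r) θ := by
    rw [hy, hpow, map_add, map_mul]
    rfl
  subst hα
  set g := X - 1 + (X - 1) ^ p ^ k * r with hg
  refine ⟨_, isKNormal_one_of_gcd hθ ?_ ?_, h1⟩
  · exact dvd_add dvd_rfl ((dvd_pow_self _ hpk).mul_right _)
  · have hgf : IsCoprime g (f' ^ p ^ k) := by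
      refine (isCoprime_of_forall_primeFactors (θ := θ) hf'0 fun Q hQ => h3 Q ?_).pow_right
      obtain ⟨k1, k2, k3⟩ := (mem_primeFactors_iff hf'0).1 hQ
      refine Finset.mem_erase.2 ⟨?_, (mem_primeFactors_iff hf).2
        ⟨k1, k2, hf' ▸ k3.mul_left _⟩⟩
      rintro rfl
      exact (hirr.coprime_iff_not_dvd.1 hcop') k3
    obtain ⟨a, b, hab⟩ := hgf
    -- Multiply `a g + b f' ^ p ^ k = 1` by `X - 1`, then replace `X - 1` by `g - (X - 1) ^ p ^ k *
    -- r` in the second term.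
    refine ⟨(X - 1) * a + b * f' ^ p ^ k, -(b * r), ?_⟩
    rw [hX, hf', mul_pow]
    linear_combination (X - 1) * hab + b * f' ^ p ^ k * hg

end Main

end SieveCriterion

/-! ### The criterion in terms of `q`, `n` and `q₀` -/

theorem mainTheorem6
    {F K : Type*} [Field F] [Finite F] [Field K] [Finite K] [Algebra F K]
    (p q n k u : ℕ) (hp : p.Prime) (hp2 : p ≠ 2) [CharP F p]
    (hq : Nat.card F = q) (hn : Module.finrank F K = n)
    (hnku : n = p ^ k * u) (hu : Nat.gcd u p = 1)
    (q' : ℕ) (hq' : q' = UniqueFactorizationMonoid.radical (q ^ n - 1))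
    (P : Finset ℕ) (hP : ∀ ℓ ∈ P, ℓ.Prime ∧ ℓ ∣ q')
    (q₀ : ℕ) (hq₀ : q₀ = q' / ∏ ℓ ∈ P, ℓ)
    (s : ℕ) (hs : s = P.card)
    (δ : ℝ) (hδ : δ = 1 - ∑ ℓ ∈ P, (ℓ : ℝ)⁻¹) (hδ_pos : 0 < δ) :
    ((q : ℝ) ^ ((n : ℝ) / 2) >
        2 * (SieveCriterion.natW q₀ : ℝ) *
          (SieveCriterion.polyW (Polynomial.X ^ u - 1 : Polynomial F) : ℝ) *
          (((s : ℝ) - 1) / δ + 2) →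
      ∃ α : K, SieveCriterion.IsNormalElement F α ∧ SieveCriterion.IsRPrimitive 2 α) ∧
    ((q : ℝ) ^ ((p : ℝ) ^ k * ((u : ℝ) / 2 - 1)) >
        (SieveCriterion.natW q₀ : ℝ) *
          (SieveCriterion.polyW (Polynomial.X ^ u - 1 : Polynomial F) : ℝ) *
          (((s : ℝ) - 1) / δ + 2) →
      ∃ α : K, SieveCriterion.IsKNormal F 1 α ∧ SieveCriterion.IsRPrimitive 2 α) := by
  have : Fintype F := Fintype.ofFinite F
  have hfact : Fact p.Prime := ⟨hp⟩
  have hn0 : 0 < n := hn ▸ Module.finrank_pos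
  have hcardK : Nat.card K = q ^ n := by
    rw [Module.natCard_eq_pow_finrank (K := F), hq, hn]
  have hqodd : Odd q := by
    have : Fintype.card F = q := by rw [← Nat.card_eq_fintype_card, hq]
    obtain ⟨m, -, hm⟩ := FiniteField.card F p
    rw [← this, hm]
    exact (hp.odd_of_ne_two hp2).pow
  have hq1 : 1 < q := hq ▸ Finite.one_lt_card
  have hodd : 2 ∣ Nat.card K - 1 := by
    rw [hcardK]
    exact (Nat.Odd.sub_odd hqodd.pow odd_one).two_dvd
  have hm0 : Nat.card K - 1 ≠ 0 := by
    have := Nat.one_lt_pow hn0.ne' hq1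
    omega
  have hPsub : P ⊆ (Nat.card K - 1).primeFactors := by
    intro ℓ hℓ
    obtain ⟨h1, h2⟩ := hP ℓ hℓ
    refine Nat.mem_primeFactors.2 ⟨h1, h2.trans ?_, hm0⟩
    rw [hq', hcardK]
    exact UniqueFactorizationMonoid.radical_dvd_self
  have hq₀' : q₀ = ∏ ℓ ∈ (Nat.card K - 1).primeFactors \ P, ℓ := by
    have h1 : q' = ∏ ℓ ∈ (Nat.card K - 1).primeFactors, ℓ := by
      rw [hq', hcardK, UniqueFactorizationMonoid.radical,
        UniqueFactorizationMonoid.primeFactors_eq_natPrimeFactors]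
      rfl
    rw [hq₀, h1, ← Finset.prod_sdiff hPsub]
    exact Nat.mul_div_cancel _ (Finset.prod_pos fun ℓ hℓ => (hP ℓ hℓ).1.pos)
  have hqpos : (0 : ℝ) < q := by exact_mod_cast hq1.le
  have hsqrt : √(Nat.card K : ℝ) = (q : ℝ) ^ ((n : ℝ) / 2) := by
    rw [hcardK, Nat.cast_pow, Real.sqrt_eq_rpow, ← Real.rpow_natCast, ← Real.rpow_mul hqpos.le]
    congr 1
    ring
  rw [hnku] at hn
  subst hs hq₀'
  constructor
  · intro h
    refine SieveCriterion.exists_isNormalElement_isRPrimitive hp hn hodd P hPsub δ hδ hδ_pos ?_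
    rw [hsqrt]
    exact h
  · intro h
    refine SieveCriterion.exists_isKNormal_one_isRPrimitive hp hn hu hodd P hPsub δ hδ hδ_pos ?_
    -- As `n / 2 = p ^ k + p ^ k (u / 2 - 1)`, the index bound `q ^ p ^ k` is exactly what turns the
    -- exponent of (b) into `n / 2`.
    have hsplit : (q : ℝ) ^ ((n : ℝ) / 2) =
        (q : ℝ) ^ p ^ k * (q : ℝ) ^ ((p : ℝ) ^ k * ((u : ℝ) / 2 - 1)) := by
      rw [← Real.rpow_natCast, ← Real.rpow_add hqpos, hnku]
      congr 1
      push_cast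
      ring
    rw [hsqrt, hsplit, hq, mul_left_comm, mul_assoc]
    exact mul_lt_mul_of_pos_left h (by positivity)
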